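/- A sequence $\mathbf v=v_0v_1v_2\cdots$ over a finite alphabet is balanced if for every letter $a$ and all factors $u,w$ of $\mathbf v$ with $|u|=|w|$ one has $|u|_a-|w|_a\le 1$, where $|u|_a$ is the number of occurrences of $a$ in $u$. The exponent of a nonempty word $z$ is $\exp(z)=|z|/p$, where $p$ is the length of the shortest nonempty word $u$ such that $z$ is a prefix of the periodic sequence $u^\omega=uuu\cdots$. The critical exponent of $\mathbf v$ is $\mathrm E(\mathbf v)=\sup\{\exp(z): z \text{ is a nonempty factor of } \mathbf v\}\in\mathbb R\cup\{+\infty\}$. **Theorem.** For each integer $d\ge 11$, there is no balanced sequence $\mathbf v$ over an alphabet with $d$ letters such that $\mathrm E(\mathbf v)<\frac{d-1}{d-2}$. -/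

import Mathlib

namespace WordSeq

variable {A : Type*}

/-- The word `v i, v (i+1), …, v (i+n-1)` of length `n` occurring at position `i` of the
sequence `v`. -/
def factorAt (v : ℕ → A) (i n : ℕ) : List A :=
  (List.range n).map (fun k => v (i + k))

/-- The language of `v`: the set of all its factors (the empty word included). -/
def language (v : ℕ → A) : Set (List A) :=
  {z | ∃ i n : ℕ, z = factorAt v i n}

/-- `v` is balanced: for every letter `a` and all factors `u`, `w` of `v` of the same length,
`|u|_a - |w|_a ≤ 1`. -/
def IsBalanced [DecidableEq A] (v : ℕ → A) : Prop :=
  ∀ a : A, ∀ u ∈ language v, ∀ w ∈ language v, u.length = w.length →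
    (u.count a : ℤ) - (w.count a : ℤ) ≤ 1

/-- The periodic sequence `u^ω = u u u ⋯` for a nonempty word `u`. -/
def omegaPower (u : List A) (hu : u ≠ []) : ℕ → A :=
  fun i => u[i % u.length]'(Nat.mod_lt i (List.length_pos_of_ne_nil hu))

/-- The (minimal) period of a word `z`: the length of the shortest nonempty word `u` such that
`z` is a prefix of `u^ω`. (For nonempty `z` such words exist, for instance `u = z`.) -/
noncomputable def minPeriod (z : List A) : ℕ :=
  sInf {p : ℕ | ∃ (u : List A) (hu : u ≠ []),
    u.length = p ∧ z = factorAt (omegaPower u hu) 0 z.length}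

/-- The exponent of a nonempty word: its length divided by its minimal period. -/
noncomputable def exponent (z : List A) : ℝ :=
  (z.length : ℝ) / (minPeriod z : ℝ)

/-- The critical exponent of `v`: the supremum, in the extended reals, of the exponents of the
nonempty factors of `v`. -/
noncomputable def criticalExponent (v : ℕ → A) : EReal :=
  ⨆ z ∈ {z : List A | z ∈ language v ∧ z ≠ []}, ((exponent z : ℝ) : EReal)

end WordSeq

/-!
Any `d - 1` consecutive letters of a sequence `v` with `E(v) < (d - 1)/(d - 2)` are distinct, so
one row of `d` letters arises from the previous one by exchanging disjoint pairs of neighbours: a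
letter returns after `d - 1`, `d` or `d + 1` positions. By the bound on the exponent, consecutive
swaps are two or three positions apart. By balance, a letter that returns once after `d - 1`
positions never returns after `d + 1`; hence nothing is swapped right below a swap, and in every
gap of length three the swap of the next row moves the gap by one place, always to the right or
always to the left. A gap drifting to the right would eventually collide with one drifting to the
left, so all gaps drift the same way. Then the swaps form an eventually periodic set, `v` itself is
eventually periodic, and its exponents are unbounded.
-/

namespace WordSeq

section Repetitions

variable {A : Type*} {v : ℕ → A}

@[simp]
theorem length_factorAt (v : ℕ → A) (i n : ℕ) : (factorAt v i n).length = n := by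
  simp [factorAt]

/-- `p` is a period of the word `z` in the sense of `minPeriod`: `z` is a prefix of `u^ω` for some
nonempty word `u` of length `p`. -/
def IsPeriod (z : List A) (p : ℕ) : Prop :=
  ∃ (u : List A) (hu : u ≠ []), u.length = p ∧ z = factorAt (omegaPower u hu) 0 z.length

theorem IsPeriod.pos {z : List A} {p : ℕ} (hp : IsPeriod z p) : 0 < p := by
  obtain ⟨u, hu, rfl, -⟩ := hp
  exact List.length_pos_of_ne_nil hu

theorem IsPeriod.div_le_exponent {z : List A} {p : ℕ} (hp : IsPeriod z p) :
    (z.length : ℝ) / p ≤ exponent z := by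
  have hmin : IsPeriod z (minPeriod z) := Nat.sInf_mem (s := {p | IsPeriod z p}) ⟨p, hp⟩
  have hpos := hmin.pos
  have hle : minPeriod z ≤ p := Nat.sInf_le hp
  unfold exponent
  gcongr

theorem exponent_le_criticalExponent {z : List A} (hz : z ∈ language v) (hne : z ≠ []) :
    (exponent z : EReal) ≤ criticalExponent v :=
  le_iSup₂ (f := fun (z : List A) (_ : z ∈ {z | z ∈ language v ∧ z ≠ []}) => (exponent z : EReal))
    z ⟨hz, hne⟩

/-- The factor of length `p + q` of `v` at position `s` is a repetition with period `p`. -/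
def HasRepetition (v : ℕ → A) (s p q : ℕ) : Prop :=
  ∀ i, s ≤ i → i < s + q → v (i + p) = v i

theorem HasRepetition.apply_add_mod {s p q : ℕ} (h : HasRepetition v s p q) (k : ℕ)
    (hk : k < p + q) : v (s + k % p) = v (s + k) := by
  induction k using Nat.strong_induction_on with
  | _ k ih =>
    rcases lt_or_ge k p with hkp | hkp
    · rw [Nat.mod_eq_of_lt hkp]
    · rcases Nat.eq_zero_or_pos p with rfl | hp
      · rw [Nat.mod_zero]
      · calc v (s + k % p) = v (s + (k - p) % p) := by rw [Nat.mod_eq_sub_mod hkp]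
          _ = v (s + (k - p)) := ih (k - p) (by omega) (by omega)
          _ = v (s + (k - p) + p) := (h _ (by omega) (by omega)).symm
          _ = v (s + k) := by congr 1; omega

theorem HasRepetition.isPeriod {s p q : ℕ} (h : HasRepetition v s p q) (hp : 0 < p) :
    IsPeriod (factorAt v s (p + q)) p := by
  have hne : factorAt v s p ≠ [] := List.ne_nil_of_length_pos (by rwa [length_factorAt])
  refine ⟨factorAt v s p, hne, length_factorAt v s p, ?_⟩
  rw [length_factorAt]
  refine List.map_congr_left fun k hk => ?_
  rw [← h.apply_add_mod k (List.mem_range.1 hk)]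
  simp [omegaPower, factorAt]

theorem HasRepetition.le_criticalExponent {s p q : ℕ} (h : HasRepetition v s p q) (hp : 0 < p) :
    ((((p + q : ℕ) : ℝ) / p : ℝ) : EReal) ≤ criticalExponent v := by
  have hexp := (h.isPeriod hp).div_le_exponent
  rw [length_factorAt] at hexp
  have hne : factorAt v s (p + q) ≠ [] :=
    List.ne_nil_of_length_pos (by rw [length_factorAt]; omega)
  exact (EReal.coe_le_coe_iff.2 hexp).trans (exponent_le_criticalExponent ⟨s, p + q, rfl⟩ hne)

/-- Every repetition in `v` has exponent less than `(m + 1) / m`: one of length `p + q` and period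
`p` satisfies `(p + q) / p < (m + 1) / m`. -/
def AvoidsRepetitions (v : ℕ → A) (m : ℕ) : Prop :=
  ∀ s p q : ℕ, 0 < p → HasRepetition v s p q → q * m < p

theorem avoidsRepetitions_of_criticalExponent_lt {m : ℕ}
    (hE : criticalExponent v < ((((m : ℝ) + 1) / m : ℝ) : EReal)) : AvoidsRepetitions v m := by
  intro s p q hp h
  rcases Nat.eq_zero_or_pos m with rfl | hm
  · simpa using hp
  have hlt : ((p + q : ℕ) : ℝ) / p < ((m : ℝ) + 1) / m :=
    EReal.coe_lt_coe_iff.1 ((h.le_criticalExponent hp).trans_lt hE)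
  rw [div_lt_div_iff₀ (by exact_mod_cast hp) (by exact_mod_cast hm)] at hlt
  have hlt' : (p + q) * m < (m + 1) * p := by exact_mod_cast hlt
  linarith

namespace AvoidsRepetitions

variable {m : ℕ}

theorem ne (h : AvoidsRepetitions v m) {i j : ℕ} (hij : i < j) (hj : j ≤ i + m) : v j ≠ v i := by
  intro heq
  have hrep : HasRepetition v i (j - i) 1 := fun k hk hk' => by
    obtain rfl : k = i := by omega
    rwa [Nat.add_sub_cancel' hij.le]
  have := h i (j - i) 1 (by omega) hrep
  omega

theorem two_mul_lt (h : AvoidsRepetitions v m) {s p : ℕ} (hp : 0 < p) (h₀ : v (s + p) = v s)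
    (h₁ : v (s + 1 + p) = v (s + 1)) : 2 * m < p := by
  refine h s p 2 hp fun i hi hi' => ?_
  obtain rfl | rfl : i = s ∨ i = s + 1 := by omega
  exacts [h₀, h₁]

end AvoidsRepetitions

end Repetitions

section EventualPeriodicity

/-- The sequence `f` is eventually periodic. -/
def EventuallyPeriodic {B : Type*} (f : ℕ → B) : Prop :=
  ∃ N, ∃ p > 0, ∀ n ≥ N, f (n + p) = f n

variable {A : Type*} {v : ℕ → A}

theorem AvoidsRepetitions.not_eventuallyPeriodic {m : ℕ} (h : AvoidsRepetitions v m)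
    (hm : 0 < m) : ¬ EventuallyPeriodic v := by
  rintro ⟨N, p, hp, hper⟩
  have hlt : p * m < p := h N p p hp fun i hi _ => hper i hi
  exact hlt.not_ge (Nat.le_mul_of_pos_right p hm)

theorem EventuallyPeriodic.exists_mul {B : Type*} {f : ℕ → B} (hf : EventuallyPeriodic f) :
    ∃ N, ∃ p > 0, ∀ k, ∀ n ≥ N, f (n + k * p) = f n := by
  obtain ⟨N, p, hp, hper⟩ := hf
  refine ⟨N, p, hp, fun k n hn => ?_⟩
  induction k with
  | zero => simp
  | succ k ih =>
    calc f (n + (k + 1) * p) = f (n + k * p + p) := by congr 1; ring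
      _ = f n := (hper _ (by omega)).trans ih

/-- The window of length `L` and the sequence `c` determine all later letters, and by the
pigeonhole principle the same window occurs at two positions that agree modulo the period of
`c`. -/
theorem EventuallyPeriodic.of_copy [Finite A] {L : ℕ} {c : ℕ → ℕ} (hc : EventuallyPeriodic c)
    (hcL : ∀ n, c n < L) (hv : ∀ n, v (n + L) = v (n + c n)) : EventuallyPeriodic v := by
  obtain ⟨N, p, hp, hper⟩ := hc.exists_mul
  obtain ⟨x, y, hxy, hwin⟩ :
      ∃ x y : ℕ, x < y ∧ ∀ k : Fin L, v (N + y * p + k) = v (N + x * p + k) := by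
    obtain ⟨x, y, hne, heq⟩ := Finite.exists_ne_map_eq_of_infinite
      fun (x : ℕ) (k : Fin L) => v (N + x * p + k)
    rcases hne.lt_or_gt with hlt | hlt
    · exact ⟨x, y, hlt, fun k => (congrFun heq k).symm⟩
    · exact ⟨y, x, hlt, congrFun heq⟩
  have hall : ∀ k, v (N + y * p + k) = v (N + x * p + k) := by
    intro k
    induction k using Nat.strong_induction_on with
    | _ k ih =>
      rcases lt_or_ge k L with hk | hk
      · exact hwin ⟨k, hk⟩
      obtain ⟨k, rfl⟩ := Nat.exists_eq_add_of_le' hk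
      have hck : c (N + y * p + k) = c (N + x * p + k) := by
        rw [show N + y * p + k = N + k + y * p by ring, show N + x * p + k = N + k + x * p by ring,
          hper y _ (by omega), hper x _ (by omega)]
      have hlt := hcL (N + x * p + k)
      rw [← add_assoc, ← add_assoc, hv, hv, hck, add_assoc, add_assoc (N + x * p)]
      exact ih _ (by omega)
  refine ⟨N + x * p, (y - x) * p, Nat.mul_pos (by omega) hp, fun n hn => ?_⟩
  obtain ⟨k, rfl⟩ := Nat.exists_eq_add_of_le hn
  rw [← hall k]
  congr 1
  obtain ⟨z, rfl⟩ := Nat.exists_eq_add_of_lt hxy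
  rw [show x + z + 1 - x = z + 1 by omega]
  ring

end EventualPeriodicity

section SwapPatterns

/-- The combinatorial properties of the set `S` of swap positions of a balanced sequence without
large repetitions. A swap at `j` exchanges the letters in columns `j` and `j + 1` between one row
of length `d` and the next; positions `n` and `n + d` lie below each other. -/
structure IsSwapPattern (S : ℕ → Prop) (d : ℕ) : Prop where
  not_succ : ∀ j, S j → ¬ S (j + 1)
  exists_near : ∀ j, S j ∨ S (j + 1) ∨ S (j + 2)
  not_below : ∀ j, S j → ¬ S (j + d)
  /-- If the letter that a swap at `j + 1` moves to the left stays in place in the next row, then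
  it is not moved to the right in the row after that. -/
  not_below_two_of_left : ∀ j, S (j + 1) → ¬ S (j + d) → ¬ S (j + 1 + d + d)
  /-- If the letter that a swap at `j` moves to the right stays in place in the next row, then it is
  not moved to the left in the row after that. -/
  not_below_two_of_right : ∀ j, S j → ¬ S (j + d + 1) → ¬ S (j + d + d)

/-- Two swaps at distance three such that the swap below the gap between them is at its left end,
so that the gap moves to the right. -/
def IsRightGap (S : ℕ → Prop) (d j : ℕ) : Prop := S j ∧ S (j + 3) ∧ S (j + d + 1)

/-- Two swaps at distance three such that the swap below the gap between them is at its right end,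
so that the gap moves to the left. -/
def IsLeftGap (S : ℕ → Prop) (d j : ℕ) : Prop := S j ∧ S (j + 3) ∧ S (j + d + 2)

namespace IsSwapPattern

variable {S : ℕ → Prop} {d : ℕ}

theorem below_of_add_two (h : IsSwapPattern S d) {j : ℕ} (hj : S j) (hj' : S (j + 2)) :
    S (j + d + 1) := by
  have h₀ := h.not_below j hj
  have h₂ := h.not_below (j + 2) hj'
  rw [add_right_comm] at h₂
  exact ((h.exists_near (j + d)).resolve_left h₀).resolve_right h₂

theorem isRightGap_or_isLeftGap (h : IsSwapPattern S d) {j : ℕ} (hj : S j) (hj' : S (j + 3)) :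
    IsRightGap S d j ∨ IsLeftGap S d j :=
  ((h.exists_near (j + d)).resolve_left (h.not_below j hj)).imp
    (fun hs => ⟨hj, hj', hs⟩) fun hs => ⟨hj, hj', hs⟩

theorem isRightGap_below (h : IsSwapPattern S d) {j : ℕ} (hj : IsRightGap S d j) :
    IsRightGap S d (j + d + 1) := by
  obtain ⟨-, h₃, hs⟩ := hj
  have hs₂ : ¬ S (j + d + 2) := h.not_succ _ hs
  have hs₃ : ¬ S (j + d + 3) := add_right_comm j 3 d ▸ h.not_below _ h₃
  have hs₄ : S (j + d + 4) := ((h.exists_near (j + d + 2)).resolve_left hs₂).resolve_left hs₃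
  refine (h.isRightGap_or_isLeftGap hs hs₄).resolve_right fun hl => ?_
  refine h.not_below_two_of_left (j + 2) h₃ (add_right_comm j 2 d ▸ hs₂) ?_
  convert hl.2.2 using 1
  ring

/-- With `i = j + d - 1`, written without truncated subtraction. -/
theorem isLeftGap_below (h : IsSwapPattern S d) {i j : ℕ} (hj : IsLeftGap S d j)
    (hi : i + 1 = j + d) : IsLeftGap S d i := by
  obtain ⟨h₀, -, hs⟩ := hj
  have hs₀ : ¬ S (i + 1) := hi ▸ h.not_below _ h₀
  have hs₁ : ¬ S (j + d + 1) := fun hc => h.not_succ _ hc hs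
  have hi₂ : ¬ S (i + 2) := by rwa [← hi] at hs₁
  have hi₃ : S (i + 3) := by rwa [← hi] at hs
  have hi₀ : S i := (h.exists_near i).resolve_right (not_or.2 ⟨hs₀, hi₂⟩)
  refine (h.isRightGap_or_isLeftGap hi₀ hi₃).resolve_left fun hr => ?_
  refine h.not_below_two_of_right j h₀ hs₁ ?_
  convert hr.2.2 using 1
  omega

theorem not_isLeftGap_add_of_isRightGap (h : IsSwapPattern S d) {n g : ℕ}
    (hr : IsRightGap S d n) : ¬ IsLeftGap S d (n + g) := by
  intro hl
  induction g using Nat.strong_induction_on generalizing n with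
  | _ g ih =>
    match g with
    | 0 => exact h.not_succ _ hr.2.2 hl.2.2
    | 1 => exact h.not_succ _ hr.1 hl.1
    | g + 2 =>
      exact ih g (by omega) (h.isRightGap_below hr) (h.isLeftGap_below hl (by omega))

theorem exists_isLeftGap_ge (h : IsSwapPattern S d) (hd : 2 ≤ d) {m : ℕ} (hm : IsLeftGap S d m)
    (n : ℕ) : ∃ k ≥ n, IsLeftGap S d k := by
  induction n with
  | zero => exact ⟨m, by omega, hm⟩
  | succ n ih =>
    obtain ⟨k, hk, hl⟩ := ih
    exact ⟨k + d - 1, by omega, h.isLeftGap_below hl (by omega)⟩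

theorem not_isLeftGap_of_isRightGap (h : IsSwapPattern S d) (hd : 2 ≤ d) {n m : ℕ}
    (hr : IsRightGap S d n) : ¬ IsLeftGap S d m := by
  intro hl
  obtain ⟨k, hk, hlk⟩ := h.exists_isLeftGap_ge hd hl n
  obtain ⟨g, rfl⟩ := Nat.exists_eq_add_of_le hk
  exact h.not_isLeftGap_add_of_isRightGap hr hlk

theorem add_of_forall_not_isLeftGap (h : IsSwapPattern S d) (hl : ∀ m, ¬ IsLeftGap S d m) {j : ℕ}
    (hj : S j) : S (j + d + 1) := by
  rcases (h.exists_near (j + 1)).resolve_left (h.not_succ j hj) with h₂ | h₃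
  · exact h.below_of_add_two hj h₂
  · exact ((h.isRightGap_or_isLeftGap hj h₃).resolve_right (hl j)).2.2

theorem add_of_forall_not_isRightGap (h : IsSwapPattern S d) (hr : ∀ m, ¬ IsRightGap S d m)
    {j : ℕ} (hj : S (j + 3)) : S (j + d + 2) := by
  rcases h.exists_near j with h₀ | h₁ | h₂
  · exact ((h.isRightGap_or_isLeftGap h₀ hj).resolve_left (hr j)).2.2
  · have := h.below_of_add_two h₁ hj
    rwa [add_right_comm j 1 d] at this
  · exact absurd hj (h.not_succ _ h₂)

theorem eventuallyPeriodic_of_shift (h : IsSwapPattern S d) {N p : ℕ} (hp : 0 < p)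
    (hshift : ∀ j ≥ N, S j → S (j + p)) : EventuallyPeriodic S := by
  refine ⟨N + 1, p, hp, fun n hn => propext ⟨fun hs => ?_, hshift n (by omega)⟩⟩
  obtain ⟨t, rfl⟩ := Nat.exists_eq_add_of_le' (show 1 ≤ n by omega)
  rcases h.exists_near t with h₀ | h₁ | h₂
  · have hs₀ := h.not_succ _ (hshift t (by omega) h₀)
    rw [add_right_comm] at hs₀
    exact absurd hs hs₀
  · exact h₁
  · have hs₂ := hshift (t + 2) (by omega) h₂
    rw [show t + 2 + p = t + 1 + p + 1 by ring] at hs₂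
    exact absurd hs₂ (h.not_succ _ hs)

theorem eventuallyPeriodic (h : IsSwapPattern S d) (hd : 2 ≤ d) : EventuallyPeriodic S := by
  by_cases hl : ∃ m, IsLeftGap S d m
  · obtain ⟨m, hm⟩ := hl
    refine h.eventuallyPeriodic_of_shift (N := 3) (p := d - 1) (by omega) fun j hj hs => ?_
    obtain ⟨t, rfl⟩ := Nat.exists_eq_add_of_le' hj
    rw [show t + 3 + (d - 1) = t + d + 2 by omega]
    exact h.add_of_forall_not_isRightGap (fun n hr => h.not_isLeftGap_of_isRightGap hd hr hm) hs
  · exact h.eventuallyPeriodic_of_shift (N := 0) (p := d + 1) (by omega) fun j _ =>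
      h.add_of_forall_not_isLeftGap (not_exists.1 hl)

end IsSwapPattern

end SwapPatterns

section Swaps

variable {A : Type*} {v : ℕ → A} {d : ℕ}

/-- The letters at positions `j` and `j + 1` are swapped when passing to the next row of length
`d`. Only the return of the letter at `j + 1` is recorded here; that the letter at `j` returns at
position `j + d + 1` then follows, see `IsSwap.apply_add_succ`. -/
def IsSwap (v : ℕ → A) (d j : ℕ) : Prop := v (j + d) = v (j + 1)

theorem IsSwap.not_succ {j : ℕ} (hj : IsSwap v d j) (h : AvoidsRepetitions v (d - 2))
    (hd : 3 ≤ d) : ¬ IsSwap v d (j + 1) := by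
  intro hj'
  unfold IsSwap at hj hj'
  have := h.two_mul_lt (s := j + 1) (p := d - 1) (by omega)
    (by rwa [show j + 1 + (d - 1) = j + d by omega])
    (by rwa [show j + 1 + 1 + (d - 1) = j + 1 + d by omega])
  omega

theorem IsSwap.apply_add_pred_ne {j : ℕ} (hj : IsSwap v d j) (h : AvoidsRepetitions v (d - 2))
    (hd : 3 ≤ d) : v (j + (d - 1)) ≠ v j := by
  intro hj'
  unfold IsSwap at hj
  have := h.two_mul_lt (by omega) hj' (by rwa [show j + 1 + (d - 1) = j + d by omega])
  omega

theorem IsBalanced.exists_apply_eq [DecidableEq A] (hv : IsBalanced v) {i l : ℕ} (hl : 0 < l)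
    (h : v (i + l) = v i) (n : ℕ) : ∃ k ∈ Set.Ico n (n + l + 1), v k = v i := by
  obtain ⟨l, rfl⟩ := Nat.exists_eq_add_of_le' hl
  by_contra! hmiss
  have hdiff := hv (v i) _ ⟨i, l + 2, rfl⟩ _ ⟨n, l + 2, rfl⟩ (by simp only [length_factorAt])
  have hzero : (factorAt v n (l + 2)).count (v i) = 0 := by
    simp only [List.count_eq_zero, factorAt, List.mem_map, List.mem_range, not_exists, not_and]
    exact fun k hk => hmiss (n + k) ⟨by omega, by omega⟩
  have htwo : 2 ≤ (factorAt v i (l + 2)).count (v i) := by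
    rw [factorAt, List.range_succ, List.range_succ_eq_map]
    simp [h, List.count_append]
  omega

/-- The letter at `i + 1` returns after `d - 1` positions, so by balance it occurs in every factor
of length `d`, but `v j` does not occur in the one that starts at `j + 1`. -/
theorem IsSwap.apply_succ_ne [DecidableEq A] {i j : ℕ} (hi : IsSwap v d i) (hj : IsSwap v d j)
    (hv : IsBalanced v) (h : AvoidsRepetitions v (d - 2)) (hd : 3 ≤ d) : v (i + 1) ≠ v j := by
  intro heq
  obtain ⟨k, ⟨hk, hk'⟩, hkj⟩ := hv.exists_apply_eq (i := i + 1) (l := d - 1) (by omega)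
    (by rwa [show i + 1 + (d - 1) = i + d by omega]) (j + 1)
  rw [heq] at hkj
  obtain hlt | rfl | rfl : k ≤ j + (d - 2) ∨ k = j + (d - 1) ∨ k = j + d := by omega
  · exact h.ne (by omega) hlt hkj
  · exact hj.apply_add_pred_ne h hd hkj
  · rw [show v (j + d) = v (j + 1) from hj] at hkj
    exact h.ne (by omega) (by omega) hkj

variable [Fintype A]

theorem AvoidsRepetitions.exists_apply_eq (h : AvoidsRepetitions v (d - 2))
    (hA : Fintype.card A ≤ d) {n : ℕ} (hn : v (n + (d - 1)) ≠ v n) (a : A) :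
    ∃ k ∈ Set.Ico n (n + d), v k = a := by
  have hne : ∀ i j : Fin d, i < j → v (n + i) ≠ v (n + j) := by
    intro i j hij
    rw [Fin.lt_def] at hij
    by_cases hfar : j.1 ≤ i.1 + (d - 2)
    · exact (h.ne (by omega) (by omega)).symm
    · rw [show n + i.1 = n by omega, show n + j.1 = n + (d - 1) by omega]
      exact hn.symm
  have hinj : Function.Injective fun k : Fin d => v (n + k) :=
    Function.Injective.of_lt_imp_ne hne
  have hcard : Fintype.card (Fin d) = Fintype.card A :=
    le_antisymm (Fintype.card_le_of_injective _ hinj) (by rwa [Fintype.card_fin])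
  obtain ⟨k, hk⟩ := ((Fintype.bijective_iff_injective_and_card _).2 ⟨hinj, hcard⟩).surjective a
  exact ⟨n + k, ⟨by omega, by omega⟩, hk⟩

theorem IsSwap.apply_add_succ {j : ℕ} (hj : IsSwap v d j) (h : AvoidsRepetitions v (d - 2))
    (hd : 3 ≤ d) (hA : Fintype.card A ≤ d) : v (j + d + 1) = v j := by
  obtain ⟨k, ⟨hk, hk'⟩, heq⟩ := h.exists_apply_eq hA (hj.apply_add_pred_ne h hd) (v (j + d + 1))
  obtain rfl | rfl | rfl | hlt : k = j ∨ k = j + 1 ∨ k = j + 2 ∨ j + 3 ≤ k := by omega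
  · exact heq.symm
  · rw [← show v (j + d) = v (j + 1) from hj] at heq
    exact absurd heq.symm (h.ne (by omega) (by omega))
  · refine absurd ?_ (hj.not_succ h hd)
    rw [IsSwap, add_right_comm]
    exact heq.symm
  · exact absurd heq.symm (h.ne (by omega) (by omega))

theorem AvoidsRepetitions.apply_add_of_not_isSwap (h : AvoidsRepetitions v (d - 2))
    (hA : Fintype.card A ≤ d) {j : ℕ} (hj : ¬ IsSwap v d j) (hj' : ¬ IsSwap v d (j + 1)) :
    v (j + 1 + d) = v (j + 1) := by
  rcases Nat.eq_zero_or_pos d with rfl | hd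
  · rfl
  have hne : v (j + 1 + (d - 1)) ≠ v (j + 1) := by rwa [show j + 1 + (d - 1) = j + d by omega]
  obtain ⟨k, ⟨hk, hk'⟩, heq⟩ := h.exists_apply_eq hA hne (v (j + 1 + d))
  obtain rfl | rfl | hlt : k = j + 1 ∨ k = j + 2 ∨ j + 3 ≤ k := by omega
  · exact heq.symm
  · exact absurd heq.symm hj'
  · exact absurd heq.symm (h.ne (by omega) (by omega))

theorem AvoidsRepetitions.exists_isSwap (h : AvoidsRepetitions v (d - 2)) (hd : 4 ≤ d)
    (hA : Fintype.card A ≤ d) (j : ℕ) : IsSwap v d j ∨ IsSwap v d (j + 1) ∨ IsSwap v d (j + 2) := by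
  by_contra! hnone
  obtain ⟨h₀, h₁, h₂⟩ := hnone
  have := h.two_mul_lt (by omega) (h.apply_add_of_not_isSwap hA h₀ h₁)
    (h.apply_add_of_not_isSwap hA h₁ h₂)
  omega

theorem AvoidsRepetitions.isSwapPattern [DecidableEq A] (h : AvoidsRepetitions v (d - 2))
    (hv : IsBalanced v) (hd : 4 ≤ d) (hA : Fintype.card A ≤ d) : IsSwapPattern (IsSwap v d) d := by
  have hd₃ : 3 ≤ d := by omega
  have hbelow : ∀ j, IsSwap v d j → ¬ IsSwap v d (j + d) := fun j hj hj' =>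
    hj.apply_succ_ne hj' hv h hd₃ hj.symm
  refine
    { not_succ := fun j hj => hj.not_succ h hd₃
      exists_near := h.exists_isSwap hd hA
      not_below := hbelow
      not_below_two_of_left := ?_
      not_below_two_of_right := ?_ }
  · intro j hj hleft hj'
    have hstay : v (j + d + 1 + d) = v (j + d + 1) :=
      h.apply_add_of_not_isSwap hA hleft (add_right_comm j 1 d ▸ hbelow _ hj)
    refine hj.apply_succ_ne hj' hv h hd₃ ?_
    rw [add_right_comm j 1 d, hstay, add_right_comm j d 1]
    exact hj.symm
  · intro j hj hright hj'
    have hstay : v (j + d + 1 + d) = v (j + d + 1) :=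
      h.apply_add_of_not_isSwap hA (hbelow _ hj) hright
    refine hj'.apply_succ_ne hj hv h hd₃ ?_
    rw [add_right_comm, hstay, hj.apply_add_succ h hd₃ hA]

open Classical in
/-- The offset `c` for which the letter at position `n + d + 1` is a copy of the one at position
`n + c`, when `S` is the set of swap positions. -/
noncomputable def copyOffset (S : ℕ → Prop) (n : ℕ) : ℕ :=
  if S n then 0 else if S (n + 1) then 2 else 1

theorem AvoidsRepetitions.apply_add_eq_copy (h : AvoidsRepetitions v (d - 2)) (hd : 3 ≤ d)
    (hA : Fintype.card A ≤ d) (n : ℕ) :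
    v (n + (d + 1)) = v (n + copyOffset (IsSwap v d) n) := by
  unfold copyOffset
  split_ifs with h₀ h₁
  · exact h₀.apply_add_succ h hd hA
  · rw [add_comm d 1, ← add_assoc]
    exact h₁
  · rw [add_comm d 1, ← add_assoc]
    exact h.apply_add_of_not_isSwap hA h₀ h₁

theorem EventuallyPeriodic.copyOffset {S : ℕ → Prop} (hS : EventuallyPeriodic S) :
    EventuallyPeriodic (copyOffset S) := by
  obtain ⟨N, p, hp, hper⟩ := hS
  refine ⟨N, p, hp, fun n hn => ?_⟩
  have h₀ : S (n + p) ↔ S n := iff_of_eq (hper n hn)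
  have h₁ : S (n + p + 1) ↔ S (n + 1) := add_right_comm n p 1 ▸ iff_of_eq (hper _ (by omega))
  classical exact if_congr h₀ rfl (if_congr h₁ rfl rfl)

theorem IsBalanced.not_avoidsRepetitions [DecidableEq A] (hv : IsBalanced v) (hd : 4 ≤ d)
    (hA : Fintype.card A ≤ d) : ¬ AvoidsRepetitions v (d - 2) := by
  intro h
  have hswaps : EventuallyPeriodic (IsSwap v d) :=
    (h.isSwapPattern hv hd hA).eventuallyPeriodic (by omega)
  have hoffset : ∀ n, copyOffset (IsSwap v d) n < d + 1 := fun n => by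
    unfold copyOffset
    split_ifs <;> omega
  exact h.not_eventuallyPeriodic (by omega)
    (hswaps.copyOffset.of_copy hoffset (h.apply_add_eq_copy (by omega) hA))

end Swaps

end WordSeq

theorem theorem3p2_general (d : ℕ) (hd : 4 ≤ d) (A : Type*) [Fintype A] [DecidableEq A]
    (hA : Fintype.card A ≤ d) :
    ¬ ∃ v : ℕ → A, WordSeq.IsBalanced v ∧
      WordSeq.criticalExponent v < ((((d : ℝ) - 1) / ((d : ℝ) - 2) : ℝ) : EReal) := by
  rintro ⟨v, hv, hE⟩
  refine hv.not_avoidsRepetitions hd hA (WordSeq.avoidsRepetitions_of_criticalExponent_lt ?_)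
  rwa [Nat.cast_sub (by omega), Nat.cast_two, show (d : ℝ) - 2 + 1 = d - 1 by ring]

theorem theorem3p2 (d : ℕ) (hd : 11 ≤ d) (A : Type*) [Fintype A] [DecidableEq A]
    (hA : Fintype.card A = d) :
    ¬ ∃ v : ℕ → A, WordSeq.IsBalanced v ∧
      WordSeq.criticalExponent v < ((((d : ℝ) - 1) / ((d : ℝ) - 2) : ℝ) : EReal) :=
  theorem3p2_general d (by omega) A hA.le
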